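/- Let $\sigma=(c_1,\dots,c_L)$ be a tuple of non-negative integers with $c_1\ge 2$, $c_L\ge 1$ and $c_i\le c_1$ for all $i$. Let $(H_n)_{n\ge 0}$ be the sequence with $H_0=1$ and $H_n=c_1H_{n-1}+\cdots+c_LH_{n-L}$ for $n\ge 1$, where $H_m=0$ for $m<0$. A representation of a non-negative integer $N$ is a finite string $[r_s,\dots,r_0]$ of non-negative integers with $N=\sum_i r_iH_i$; its number of summands is $\sum_i r_i$. An allowable block is a string $[c_1,\dots,c_{k-1},b]$ with $1\le k\le L$ and $0\le b<c_k$. A generalized Zeckendorf decomposition (gzd) of $N$ is a representation of $N$ that is a concatenation of allowable blocks; it is unique up to leading zeros. Suppose that $\sigma$ is not weakly decreasing, let $t$ be the least index with $1\le t<L$ and $c_t<c_{t+1}$, and suppose that $c_{t+1}<c_1$. Then there is an $n\ge 0$ such that the representation $[c_1+1,0,\dots,0]$ (with $n$ zeros) of $(c_1+1)H_n$ has fewer summands than the gzd of $(c_1+1)H_n$; that is, the gzd of $(c_1+1)H_n$ exists and uses more than $c_1+1$ summands. -/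

import Mathlib

namespace PLRS

/-- The coefficient `c_i` (1-indexed) of a signature `σ = [c_1, …, c_L]`; it is `0` for `i = 0`
and for `i > L`. -/
def coeff (σ : List ℕ) : ℕ → ℕ
  | 0 => 0
  | i + 1 => σ.getD i 0

/-- `σ = [c_1, …, c_L]` is the signature of a positive linear recurrence: it is nonempty, its
entries are non-negative integers, and `c_1, c_L ≥ 1`. -/
def IsSignature (σ : List ℕ) : Prop :=
  σ ≠ [] ∧ 1 ≤ coeff σ 1 ∧ 1 ≤ coeff σ σ.length

/-- The sequence `H_σ` with ideal initial conditions: `H_0 = 1`, `H_m = 0` for `m < 0`, and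
`H_{n+1} = c_1 H_n + c_2 H_{n-1} + ⋯ + c_L H_{n+1-L}` for `n ≥ 0`. Terms of negative index
vanish and are left out; terms with `i + 1 > L` have coefficient `0`. -/
def H (σ : List ℕ) : ℕ → ℕ
  | 0 => 1
  | n + 1 => ∑ i : Fin (n + 1), coeff σ (i + 1) * H σ (n - i)

/-- The integer `∑ r_i H_i` represented by the string `[r_s, …, r_1, r_0]`, which is written
with its highest index first. -/
def value (σ : List ℕ) : List ℕ → ℕ
  | [] => 0
  | r :: R => r * H σ R.length + value σ R

/-- `R` is a representation of `N` using `H_σ`. -/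
def IsRepresentation (σ R : List ℕ) (N : ℕ) : Prop :=
  value σ R = N

/-- The number of summands, counted with multiplicity, that a representation uses. -/
def numSummands (R : List ℕ) : ℕ :=
  R.sum

/-- Allowable blocks `[c_1, …, c_{k-1}, b]` with `1 ≤ k ≤ L` and `0 ≤ b < c_k`. -/
def IsAllowableBlock (σ B : List ℕ) : Prop :=
  ∃ k b : ℕ, 1 ≤ k ∧ k ≤ σ.length ∧ b < coeff σ k ∧ B = σ.take (k - 1) ++ [b]

/-- `R` is a generalized Zeckendorf decomposition of `N`: a representation of `N` that is a
concatenation of allowable blocks. Leading blocks `[0]` are permitted; they change neither the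
integer represented nor the number of summands. -/
def IsGZD (σ R : List ℕ) (N : ℕ) : Prop :=
  IsRepresentation σ R N ∧
    ∃ Bs : List (List ℕ), (∀ B ∈ Bs, IsAllowableBlock σ B) ∧ R = Bs.flatten

/-- The string `S` shifted `n` places to the left, `[S, 0, …, 0]` with `n` zeros. -/
def shifted (S : List ℕ) (n : ℕ) : List ℕ :=
  S ++ List.replicate n 0

end PLRS

/-! Let c_{j+1} start the constant run ending at the ascent, so that c_1 ≥ ⋯ ≥ c_j > c_{j+1} = ⋯ =
c_t < c_{t+1} < c_1, and put n = j + m. The recurrences for H_{n+1} and H_n give (c_1+1)H_n =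
H_{n+1} + ∑_{i=1}^{n} (c_i − c_{i+1})H_{n−i}. Borrowing one unit at the descent i = j leaves the
digits 1, 0, c_1−c_2, …, c_{j−1}−c_j, c_j−c_{j+1}−1, whose sum telescopes to c_1 − c_{j+1}, followed
by a string R of length m (`exists_valid_of_low_part`). So it suffices that R has digit sum at least
c_{j+1} + 2 (`exists_low_part`).

For m = t − j, R decomposes H_m − (c_{t+1} − c_t), and `exists_valid_tail_sub` bounds its sum. The
bound falls one short only when t = j + 1 and c_{t+1} = c_1 − 1; then some m in {2, 3, 4} works.
Uniqueness (`Valid.sum_eq`) transfers the count to every gzd. -/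

namespace PLRS

/-! ### Tails of the recurrence, and block concatenations read digit by digit -/

/-- `tail σ k m = c_{k+1} H_{m-1} + c_{k+2} H_{m-2} + ⋯ + c_{k+m} H_0`. -/
def tail (σ : List ℕ) : ℕ → ℕ → ℕ
  | _, 0 => 0
  | k, m + 1 => coeff σ (k + 1) * H σ m + tail σ (k + 1) m

/-- `Valid σ k R` says that `[c_1, …, c_k] ++ R` is a concatenation of allowable blocks whose
first block extends `[c_1, …, c_k]`. -/
def Valid (σ : List ℕ) : ℕ → List ℕ → Prop
  | k, [] => k = 0
  | k, r :: R =>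
    (r < coeff σ (k + 1) ∧ Valid σ 0 R) ∨ (r = coeff σ (k + 1) ∧ Valid σ (k + 1) R)

theorem tail_eq_sum (σ : List ℕ) (k m : ℕ) :
    tail σ k m = ∑ i : Fin m, coeff σ (k + i + 1) * H σ (m - 1 - i) := by
  induction m generalizing k with
  | zero => simp [tail]
  | succ m ih =>
    rw [tail, ih, Fin.sum_univ_succ]
    simp only [Fin.val_zero, Fin.val_succ, add_zero, Nat.add_sub_cancel, Nat.sub_zero]
    congr 1
    refine Finset.sum_congr rfl fun i _ => ?_
    congr 2
    · ring
    · omega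

theorem H_succ (σ : List ℕ) (m : ℕ) : H σ (m + 1) = tail σ 0 (m + 1) := by
  rw [tail_eq_sum, H]
  simp

theorem tail_zero_of_pos (σ : List ℕ) {m : ℕ} (hm : 0 < m) : tail σ 0 m = H σ m := by
  obtain ⟨m, rfl⟩ := Nat.exists_eq_succ_of_ne_zero hm.ne'
  exact (H_succ σ m).symm

theorem lt_length_of_coeff_pos {σ : List ℕ} {k : ℕ} (h : 0 < coeff σ (k + 1)) :
    k < σ.length := by
  by_contra hk
  have : coeff σ (k + 1) = 0 := List.getD_eq_default _ _ (by omega)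
  omega

theorem take_succ_eq {σ : List ℕ} {k : ℕ} (h : k < σ.length) :
    σ.take (k + 1) = σ.take k ++ [coeff σ (k + 1)] := by
  rw [List.take_succ_eq_append_getElem h]
  simp [coeff, h]

theorem Valid.lt_length {σ : List ℕ} (hσ : σ ≠ []) {k : ℕ} {R : List ℕ} (h : Valid σ k R) :
    k < σ.length := by
  induction R generalizing k with
  | nil => simp only [Valid] at h; subst h; exact List.length_pos_iff.2 hσ
  | cons r R ih =>
    rcases h with ⟨h, -⟩ | ⟨-, h⟩
    · exact lt_length_of_coeff_pos (by omega)
    · have := ih h; omega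

theorem Valid.exists_blocks {σ : List ℕ} (hσ : σ ≠ []) {k : ℕ} {R : List ℕ}
    (h : Valid σ k R) :
    ∃ Bs : List (List ℕ), (∀ B ∈ Bs, IsAllowableBlock σ B) ∧ σ.take k ++ R = Bs.flatten := by
  induction R generalizing k with
  | nil =>
    simp only [Valid] at h
    subst h
    exact ⟨[], by simp, by simp⟩
  | cons r R ih =>
    rcases h with ⟨h, h'⟩ | ⟨h, h'⟩
    · obtain ⟨Bs, hB, hR⟩ := ih h'
      refine ⟨(σ.take k ++ [r]) :: Bs, ?_, ?_⟩
      · intro B hB'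
        rcases List.mem_cons.1 hB' with rfl | hB'
        · exact ⟨k + 1, r, by omega, lt_length_of_coeff_pos (by omega), h, rfl⟩
        · exact hB B hB'
      · rw [List.flatten_cons, ← hR]
        simp
    · obtain ⟨Bs, hB, hR⟩ := ih h'
      refine ⟨Bs, hB, ?_⟩
      have hk := h'.lt_length hσ
      rw [← hR, take_succ_eq (by omega), h]
      simp

theorem valid_drop_take {σ : List ℕ} {k l : ℕ} {R : List ℕ} (hkl : k ≤ l)
    (hl : l ≤ σ.length) (h : Valid σ l R) : Valid σ k ((σ.take l).drop k ++ R) := by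
  induction l, hkl using Nat.le_induction generalizing R with
  | base =>
    rw [List.drop_eq_nil_of_le (List.length_take_le _ _)]
    exact h
  | succ l hkl ih =>
    have hlen : k ≤ (σ.take l).length := by rw [List.length_take]; omega
    rw [take_succ_eq (by omega), List.drop_append_of_le_length hlen, List.append_assoc]
    exact ih (by omega) (Or.inr ⟨rfl, h⟩)

theorem valid_flatten {σ : List ℕ} {Bs : List (List ℕ)}
    (h : ∀ B ∈ Bs, IsAllowableBlock σ B) : Valid σ 0 Bs.flatten := by
  induction Bs with
  | nil => rfl
  | cons B Bs ih =>
    obtain ⟨k, b, hk, hkL, hb, rfl⟩ := h B (by simp)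
    have hBs := ih fun B hB => h B (by simp [hB])
    obtain ⟨k, rfl⟩ := Nat.exists_eq_add_of_le' hk
    have hv : Valid σ k (b :: Bs.flatten) := Or.inl ⟨hb, hBs⟩
    simpa using valid_drop_take (Nat.zero_le k) (by omega) hv

theorem isGZD_iff {σ : List ℕ} (hσ : σ ≠ []) {R : List ℕ} {N : ℕ} :
    IsGZD σ R N ↔ value σ R = N ∧ Valid σ 0 R := by
  constructor
  · rintro ⟨h, Bs, hB, rfl⟩
    exact ⟨h, valid_flatten hB⟩
  · rintro ⟨h, hv⟩
    obtain ⟨Bs, hB, hR⟩ := hv.exists_blocks hσ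
    exact ⟨h, Bs, hB, by simpa using hR⟩

/-! ### Size bounds and uniqueness of the gzd -/

/-- The two bounds feed each other: a digit that closes its block leaves less than one H, a matched
digit passes to the next tail. -/
theorem Valid.value_lt {σ : List ℕ} {k : ℕ} {R : List ℕ} (h : Valid σ k R) :
    (k = 0 → value σ R < H σ R.length) ∧ (R ≠ [] → value σ R < tail σ k R.length) := by
  induction R generalizing k with
  | nil => simp [value, H]
  | cons r R ih =>
    have key : value σ (r :: R) < tail σ k (R.length + 1) := by
      simp only [value, tail]
      rcases h with ⟨h, h'⟩ | ⟨h, h'⟩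
      · have h1 := (ih h').1 rfl
        have h2 : (r + 1) * H σ R.length ≤ coeff σ (k + 1) * H σ R.length :=
          Nat.mul_le_mul_right _ h
        rw [add_mul] at h2
        omega
      · have hR : R ≠ [] := by
          rintro rfl
          simp [Valid] at h'
        rw [h]
        have := (ih h').2 hR
        omega
    refine ⟨?_, fun _ => key⟩
    rintro rfl
    rw [List.length_cons, H_succ]
    exact key

theorem Valid.value_lt_value_cons {σ : List ℕ} {r r' : ℕ} {R R' : List ℕ}
    (hR : Valid σ 0 R) (hlen : R.length = R'.length) (hr : r < r') :
    value σ (r :: R) < value σ (r' :: R') := by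
  simp only [value]
  have h1 := hR.value_lt.1 rfl
  have h2 : (r + 1) * H σ R.length ≤ r' * H σ R.length := Nat.mul_le_mul_right _ hr
  rw [add_mul] at h2
  rw [← hlen]
  omega

/-- At the first difference the smaller digit closes its block, so what follows it is worth less
than one unit of the larger digit. -/
theorem Valid.eq_of_value_eq {σ : List ℕ} {k : ℕ} {R R' : List ℕ} (h : Valid σ k R)
    (h' : Valid σ k R') (hlen : R.length = R'.length) (hval : value σ R = value σ R') :
    R = R' := by
  induction R generalizing k R' with
  | nil => exact (List.length_eq_zero_iff.1 hlen.symm).symm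
  | cons r R ih =>
    obtain _ | ⟨r', R'⟩ := R'
    · simp at hlen
    have hlen' : R.length = R'.length := by simpa using hlen
    have tails : r = r' → value σ R = value σ R' := by
      rintro rfl
      simp only [value, hlen'] at hval
      omega
    rcases h with ⟨h, hR⟩ | ⟨h, hR⟩ <;> rcases h' with ⟨h', hR'⟩ | ⟨h', hR'⟩
    · rcases lt_trichotomy r r' with hr | hr | hr
      · exact absurd hval (hR.value_lt_value_cons hlen' hr).ne
      · rw [hr, ih hR hR' hlen' (tails hr)]
      · exact absurd hval (hR'.value_lt_value_cons hlen'.symm hr).ne'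
    · exact absurd hval (hR.value_lt_value_cons hlen' (by omega)).ne
    · exact absurd hval (hR'.value_lt_value_cons hlen'.symm (by omega)).ne'
    · have hr : r = r' := by omega
      rw [hr, ih hR hR' hlen' (tails hr)]

theorem value_replicate_zero_append (σ R : List ℕ) (n : ℕ) :
    value σ (List.replicate n 0 ++ R) = value σ R := by
  induction n with
  | zero => simp
  | succ n ih => simp [List.replicate_succ, value, ih]

theorem Valid.replicate_zero_append {σ R : List ℕ} (hc : 0 < coeff σ 1) (h : Valid σ 0 R)
    (n : ℕ) : Valid σ 0 (List.replicate n 0 ++ R) := by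
  induction n with
  | zero => simpa using h
  | succ n ih => exact Or.inl ⟨hc, ih⟩

theorem Valid.sum_eq {σ R R' : List ℕ} (hc : 0 < coeff σ 1) (h : Valid σ 0 R)
    (h' : Valid σ 0 R') (hval : value σ R = value σ R') : R.sum = R'.sum := by
  have := (h.replicate_zero_append hc R'.length).eq_of_value_eq
    (h'.replicate_zero_append hc R.length) (by simp [add_comm])
    (by simpa only [value_replicate_zero_append] using hval)
  simpa using congrArg List.sum this

theorem value_replicate_zero (σ : List ℕ) (n : ℕ) : value σ (List.replicate n 0) = 0 := by
  simpa [value] using value_replicate_zero_append σ [] n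

/-! ### Explicit decompositions by borrowing -/

theorem coeff_one_le_H (σ : List ℕ) (hc : 0 < coeff σ 1) (m : ℕ) :
    coeff σ 1 ≤ H σ (m + 1) ∧ 0 < H σ m := by
  induction m with
  | zero => simp [H]
  | succ m ih =>
    refine ⟨?_, by omega⟩
    rw [H_succ, tail]
    have : coeff σ (0 + 1) * 1 ≤ coeff σ (0 + 1) * H σ (m + 1) :=
      Nat.mul_le_mul_left _ (by omega)
    simp only [zero_add, mul_one] at this ⊢
    omega

/-- The decomposition of `tail σ k m - δ` for a small positive `δ`. -/
theorem exists_valid_tail_sub {σ : List ℕ} {k m δ : ℕ} (hδ : 1 ≤ δ)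
    (hδ' : δ < coeff σ 1) (hle : δ ≤ tail σ k m) :
    ∃ R : List ℕ, R.length = m ∧ Valid σ k R ∧ value σ R + δ = tail σ k m ∧
      coeff σ (k + 1) ≤ R.sum + δ ∧ (2 ≤ m → coeff σ (k + 1) + 1 ≤ R.sum + δ) := by
  induction m generalizing k δ with
  | zero => simp [tail] at hle; omega
  | succ m ih =>
    rw [tail] at hle ⊢
    by_cases h1 : δ ≤ tail σ (k + 1) m
    · obtain ⟨R, hlen, hv, hval, -, -⟩ := ih hδ hδ' h1
      refine ⟨coeff σ (k + 1) :: R, by simp [hlen], Or.inr ⟨rfl, hv⟩, ?_, ?_, ?_⟩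
      · simp only [value, hlen]; omega
      · simp only [List.sum_cons]; omega
      · simp only [List.sum_cons]; omega
    · have hd : 1 ≤ coeff σ (k + 1) := by
        by_contra h0
        have : coeff σ (k + 1) = 0 := by omega
        rw [this] at hle
        omega
      obtain _ | m := m
      · simp only [tail, H] at hle ⊢
        refine ⟨[coeff σ (k + 1) - δ], rfl, Or.inl ⟨by omega, rfl⟩, ?_, ?_, by omega⟩
        · simp [value, H]; omega
        · simp; omega
      -- The unit H_{m+1} taken from this digit is at least c_1 > δ, so it covers the remaining
      -- deficit; its own digits repay the lost summand.
      · have hH := (coeff_one_le_H σ (by omega) m).1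
        rw [H_succ] at hH
        obtain ⟨R, hlen, hv, hval, hs, -⟩ := ih (k := 0) (δ := δ - tail σ (k + 1) (m + 1))
          (by omega) (by omega) (by omega)
        rw [zero_add] at hs
        rw [← H_succ] at hval
        refine ⟨(coeff σ (k + 1) - 1) :: R, by simp [hlen], Or.inl ⟨by omega, hv⟩, ?_, ?_, ?_⟩
        · obtain ⟨d, hd'⟩ := Nat.exists_eq_add_of_le' hd
          simp only [value, hlen, hd', Nat.add_sub_cancel, add_mul]
          omega
        · simp only [List.sum_cons]; omega
        · simp only [List.sum_cons]; omega

/-- Shifting the coefficients of `tail` by one, when they are constant except for the last. -/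
theorem tail_succ_add {σ : List ℕ} {e m k : ℕ}
    (h : ∀ i ≤ m, coeff σ (k + i + 1) = e) :
    tail σ (k + 1) (m + 1) + e = tail σ k (m + 1) + coeff σ (k + m + 2) := by
  induction m generalizing k with
  | zero =>
    have := h 0 le_rfl
    simp only [add_zero] at this
    simp only [tail, H, add_zero, mul_one, this]
    exact add_comm _ _
  | succ m ih =>
    have h0 := h 0 (by omega)
    have h1 := h 1 (by omega)
    have := ih (k := k + 1) fun i hi => by
      rw [← h (i + 1) (by omega)]; congr 1; ring
    rw [tail, tail.eq_2 σ k]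
    simp only [add_zero] at h0
    rw [h0, h1]
    rw [show k + (m + 1) + 2 = k + 1 + m + 2 by ring]
    omega

/-- A decomposition of `H_m + ∑ i, (c_{j+i} - c_{j+i+1}) H_{m-i}`, that is, of the low-order part
of `(c_1 + 1) H_{j+m}` after one unit has been borrowed at the descent `c_{j+1} < c_j`, extends
to a decomposition of `(c_1 + 1) H_{j+m}`. -/
theorem exists_valid_of_low_part {σ : List ℕ} {j m : ℕ} {R : List ℕ} (hj : 1 ≤ j)
    (hc : 2 ≤ coeff σ 1) (hmax : ∀ i, coeff σ i ≤ coeff σ 1)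
    (hanti : ∀ i, 1 ≤ i → i ≤ j → coeff σ (i + 1) ≤ coeff σ i)
    (hlt : coeff σ (j + 1) < coeff σ j) (hlen : R.length = m) (hv : Valid σ 0 R)
    (hval : value σ R + tail σ (j + 1) m = H σ m + tail σ j m) :
    ∃ R' : List ℕ, Valid σ 0 R' ∧ value σ R' = (coeff σ 1 + 1) * H σ (j + m) ∧
      R'.sum + coeff σ (j + 1) = coeff σ 1 + R.sum := by
  -- Build the digits c_i − c_{i+1} leftwards from the descent, where the unit is borrowed.
  have key : ∀ a i, a + i + 1 = j → coeff σ (j + 1) < coeff σ (i + 1) ∧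
      ∃ E : List ℕ, E.length = a + 1 + m ∧ Valid σ 0 E ∧
        value σ E + tail σ (i + 1) (a + 1 + m) = tail σ i (a + 1 + m) ∧
        E.sum + coeff σ (j + 1) + 1 = coeff σ (i + 1) + R.sum := by
    intro a
    induction a with
    | zero =>
      rintro i hi
      obtain rfl : j = i + 1 := by omega
      refine ⟨hlt, (coeff σ (i + 1) - coeff σ (i + 1 + 1) - 1) :: R, by simp [hlen, add_comm],
        Or.inl ⟨?_, hv⟩, ?_, ?_⟩
      · have := hmax (i + 1)
        rw [zero_add]; omega
      · obtain ⟨e, he⟩ := Nat.exists_eq_add_of_lt hlt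
        have : coeff σ (i + 1) - coeff σ (i + 1 + 1) - 1 = e := by omega
        rw [this, zero_add, add_comm 1 m, tail, tail.eq_2 σ i, he]
        simp only [value, hlen, add_mul]
        omega
      · simp only [List.sum_cons]; omega
    | succ a ih =>
      intro i hi
      obtain ⟨hpos, E, hEl, hEv, hEval, hEs⟩ := ih (i + 1) (by omega)
      have hstep := hanti (i + 1) (by omega) (by omega)
      refine ⟨by omega, (coeff σ (i + 1) - coeff σ (i + 1 + 1)) :: E, by simp [hEl]; ring,
        Or.inl ⟨?_, hEv⟩, ?_, ?_⟩
      · have := hmax (i + 1)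
        rw [zero_add]; omega
      · obtain ⟨e, he⟩ := Nat.exists_eq_add_of_le hstep
        have : coeff σ (i + 1) - coeff σ (i + 1 + 1) = e := by omega
        rw [this, show a + 1 + 1 + m = (a + 1 + m) + 1 by ring, tail, tail.eq_2 σ i, he]
        simp only [value, hEl, add_mul]
        omega
      · simp only [List.sum_cons]; omega
  obtain ⟨-, E, hEl, hEv, hEval, hEs⟩ := key (j - 1) 0 (by omega)
  rw [show j - 1 + 1 + m = j + m by omega] at hEl hEval
  rw [tail_zero_of_pos σ (by omega)] at hEval
  rw [zero_add] at hEs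
  refine ⟨1 :: 0 :: E, Or.inl ⟨by rw [zero_add]; omega, Or.inl ⟨by rw [zero_add]; omega, hEv⟩⟩,
    ?_, ?_⟩
  · simp only [value, List.length_cons, hEl, one_mul, zero_mul, zero_add]
    rw [H_succ, tail, add_mul, one_mul, ← hEval]
    simp only [zero_add]
    ring
  · simp only [List.sum_cons]; omega

theorem Valid.cons_of_lt {σ R : List ℕ} {r : ℕ} (hr : r < coeff σ 1) (h : Valid σ 0 R) :
    Valid σ 0 (r :: R) :=
  Or.inl ⟨hr, h⟩

/-! ### The exceptional case -/

/-- The low-order part in the case `c_j > c_{j+1} < c_{j+2} = c_1 - 1`. -/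
theorem exists_low_part_of_adjacent {σ : List ℕ} {j : ℕ} (hj : 1 ≤ j) (hc : 2 ≤ coeff σ 1)
    (hmax : ∀ i, coeff σ i ≤ coeff σ 1)
    (hanti : ∀ i k, 1 ≤ i → i ≤ k → k ≤ j + 1 → coeff σ k ≤ coeff σ i)
    (hlt : coeff σ (j + 1) < coeff σ j) (hup : coeff σ (j + 1) < coeff σ (j + 2))
    (hadj : coeff σ (j + 2) + 1 = coeff σ 1) :
    ∃ m : ℕ, ∃ R : List ℕ, R.length = m ∧ Valid σ 0 R ∧
      value σ R + tail σ (j + 1) m = H σ m + tail σ j m ∧ coeff σ (j + 1) + 2 ≤ R.sum := by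
  have hx2 := hanti 2 (j + 1) (by omega) (by omega) le_rfl
  have hb := hmax 2
  have hy := hmax (j + 3)
  have hz := hmax (j + 4)
  have H0 : H σ 0 = 1 := by simp [H]
  have H1 : H σ 1 = coeff σ 1 := by simp [H]
  have H2 : H σ 2 = coeff σ 1 * H σ 1 + coeff σ 2 := by simp [H_succ, tail, H0]
  have H3 : H σ 3 = coeff σ 1 * H σ 2 + coeff σ 2 * H σ 1 + coeff σ 3 := by
    simp [H_succ, tail, H0]; ring
  have H4 : H σ 4 = coeff σ 1 * H σ 3 + coeff σ 2 * H σ 2 + coeff σ 3 * H σ 1 + coeff σ 4 := by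
    simp [H_succ, tail, H0]; ring
  have T2 : ∀ k, tail σ k 2 = coeff σ (k + 1) * H σ 1 + coeff σ (k + 2) := by
    intro k; simp [tail, H0]
  have T3 : ∀ k, tail σ k 3 =
      coeff σ (k + 1) * H σ 2 + coeff σ (k + 2) * H σ 1 + coeff σ (k + 3) := by
    intro k; simp [tail, H0]; ring
  have T4 : ∀ k, tail σ k 4 = coeff σ (k + 1) * H σ 3 + coeff σ (k + 2) * H σ 2 +
      coeff σ (k + 3) * H σ 1 + coeff σ (k + 4) := by
    intro k; simp [tail, H0]; ring
  have V2 : ∀ a b, value σ [a, b] = a * H σ 1 + b := by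
    intro a b; simp [value, H0]
  have V3 : ∀ a b c, value σ [a, b, c] = a * H σ 2 + b * H σ 1 + c := by
    intro a b c; simp [value, H0]; ring
  have V4 : ∀ a b c d, value σ [a, b, c, d] = a * H σ 3 + b * H σ 2 + c * H σ 1 + d := by
    intro a b c d; simp [value, H0]; ring
  have valid2 : ∀ a b, a < coeff σ 1 → b < coeff σ 1 → Valid σ 0 [a, b] := fun a b ha hb =>
    .cons_of_lt ha (.cons_of_lt hb rfl)
  have valid3 : ∀ a b c, a < coeff σ 1 → b < coeff σ 1 → c < coeff σ 1 →
      Valid σ 0 [a, b, c] := fun a b c ha hb hc => .cons_of_lt ha (valid2 b c hb hc)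
  have valid4 : ∀ a b c d, a < coeff σ 1 → b < coeff σ 1 → c < coeff σ 1 → d < coeff σ 1 →
      Valid σ 0 [a, b, c, d] := fun a b c d ha hb hc hd => .cons_of_lt ha (valid3 b c d hb hc hd)
  have R2 : ∀ a q, Valid σ 0 [a, q] → coeff σ (j + 1) + 2 ≤ a + q →
      a * coeff σ 1 + q + (coeff σ (j + 2) * coeff σ 1 + coeff σ (j + 3)) =
        coeff σ 1 * coeff σ 1 + coeff σ 2 + (coeff σ (j + 1) * coeff σ 1 + coeff σ (j + 2)) →
      ∃ m : ℕ, ∃ R : List ℕ, R.length = m ∧ Valid σ 0 R ∧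
        value σ R + tail σ (j + 1) m = H σ m + tail σ j m ∧ coeff σ (j + 1) + 2 ≤ R.sum := by
    intro a q hv hs h
    refine ⟨2, [a, q], rfl, hv, ?_, by simpa using hs⟩
    rw [V2, T2, T2, H2, H1]
    exact h
  have R3 : ∀ a q r, Valid σ 0 [a, q, r] → coeff σ (j + 1) + 2 ≤ a + (q + r) →
      a * H σ 2 + q * coeff σ 1 + r +
          (coeff σ (j + 2) * H σ 2 + coeff σ (j + 3) * coeff σ 1 + coeff σ (j + 4)) =
        coeff σ 1 * H σ 2 + coeff σ 2 * coeff σ 1 + coeff σ 3 +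
          (coeff σ (j + 1) * H σ 2 + coeff σ (j + 2) * coeff σ 1 + coeff σ (j + 3)) →
      ∃ m : ℕ, ∃ R : List ℕ, R.length = m ∧ Valid σ 0 R ∧
        value σ R + tail σ (j + 1) m = H σ m + tail σ j m ∧ coeff σ (j + 1) + 2 ≤ R.sum := by
    intro a q r hv hs h
    refine ⟨3, [a, q, r], rfl, hv, ?_, by simpa using hs⟩
    rw [V3, T3, T3, H3, H1]
    exact h
  have R4 : ∀ a q r s, Valid σ 0 [a, q, r, s] → coeff σ (j + 1) + 2 ≤ a + (q + (r + s)) →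
      a * H σ 3 + q * H σ 2 + r * coeff σ 1 + s +
          (coeff σ (j + 2) * H σ 3 + coeff σ (j + 3) * H σ 2 + coeff σ (j + 4) * coeff σ 1 +
            coeff σ (j + 5)) =
        coeff σ 1 * H σ 3 + coeff σ 2 * H σ 2 + coeff σ 3 * coeff σ 1 + coeff σ 4 +
          (coeff σ (j + 1) * H σ 3 + coeff σ (j + 2) * H σ 2 + coeff σ (j + 3) * coeff σ 1 +
            coeff σ (j + 4)) →
      ∃ m : ℕ, ∃ R : List ℕ, R.length = m ∧ Valid σ 0 R ∧
        value σ R + tail σ (j + 1) m = H σ m + tail σ j m ∧ coeff σ (j + 1) + 2 ≤ R.sum := by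
    intro a q r s hv hs h
    refine ⟨4, [a, q, r, s], rfl, hv, ?_, by simpa using hs⟩
    rw [V4, T4, T4, H4, H1]
    exact h
  generalize (∃ m : ℕ, ∃ R : List ℕ, R.length = m ∧ Valid σ 0 R ∧
    value σ R + tail σ (j + 1) m = H σ m + tail σ j m ∧
    coeff σ (j + 1) + 2 ≤ R.sum) = P at R2 R3 R4 ⊢
  rw [H1] at H2
  rw [H1, H2] at H3
  obtain ⟨c', hc'⟩ : ∃ c', coeff σ (j + 2) = c' := ⟨_, rfl⟩
  have hc1 : coeff σ 1 = c' + 1 := by omega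
  -- For m = 2 the target is (c_{j+1}+1)c_1 + w with w = c_{j+2} + c_2 − c_{j+3}; w ≥ 1 suffices,
  -- with a carry if w ≥ c_1.
  by_cases hpos : coeff σ (j + 3) < c' + coeff σ 2
  · obtain ⟨w, hw⟩ := Nat.exists_eq_add_of_le hpos.le
    by_cases hwc : w < coeff σ 1
    · refine R2 (coeff σ (j + 1) + 1) w (valid2 _ _ (by omega) hwc) (by omega) ?_
      rw [hc', hc1]
      linarith
    · obtain ⟨v, rfl⟩ := Nat.exists_eq_add_of_le (not_lt.1 hwc)
      refine R2 (coeff σ (j + 1) + 2) v ?_ (by omega) ?_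
      · rcases Nat.lt_or_ge (coeff σ (j + 1) + 2) (coeff σ 1) with h | h
        · exact valid2 _ _ h (by omega)
        -- The carry made the first digit c_1, so the block continues; it closes because v < c_2.
        · exact Or.inr ⟨by rw [zero_add]; omega, Or.inl ⟨by simp; omega, rfl⟩⟩
      · rw [hc', hc1] at *
        linarith
  -- Now c_{j+3} ≥ c_1 − 1 + c_2, which forces c_2 ≤ 1.
  obtain hb0 | hb1 : coeff σ 2 = 0 ∨ 1 ≤ coeff σ 2 := by omega
  · -- then `j = 1`
    obtain rfl : j = 1 := by
      by_contra hne
      have := hanti 2 j (by omega) (by omega) (by omega)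
      omega
    norm_num at hc' hpos hy hz R2 R3 R4 hup hadj hlt
    rw [hb0] at H2 H3 hpos R2 R3 R4
    rw [hc', hc1] at R2 R3 R4
    rw [hc1] at H2 H3
    rw [hc'] at H3
    have hq := hmax 6
    have hy' : coeff σ 4 = c' + 1 ∨ coeff σ 4 = c' := by omega
    -- If c_4 = c_1, two digits suffice unless c_1 = 2. If c_4 = c_1 − 1, three suffice unless c_1 =
    -- c_5 = 2. The leftovers are finite checks on c_5 and c_6.
    rcases hy' with hy' | hy' <;> rw [hy'] at R2 R3 R4
    · by_cases hc2 : 2 ≤ c'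
      · refine R2 0 c' (valid2 _ _ (by omega) (by omega)) (by omega) ?_
        linarith
      obtain rfl : c' = 1 := by omega
      obtain hz' | hz' | hz' : coeff σ 5 = 0 ∨ coeff σ 5 = 1 ∨ coeff σ 5 = 2 := by omega
      · refine R3 1 0 1 (valid3 _ _ _ (by omega) (by omega) (by omega)) (by omega) ?_
        omega
      · obtain hq' | hq' | hq' : coeff σ 6 = 0 ∨ coeff σ 6 = 1 ∨ coeff σ 6 = 2 := by omega
        · refine R4 1 0 1 1 (valid4 _ _ _ _ ?_ ?_ ?_ ?_) ?_ ?_ <;> omega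
        · refine R4 1 0 1 0 (valid4 _ _ _ _ ?_ ?_ ?_ ?_) ?_ ?_ <;> omega
        · refine R4 1 0 0 1 (valid4 _ _ _ _ ?_ ?_ ?_ ?_) ?_ ?_ <;> omega
      · refine R3 0 1 1 (valid3 _ _ _ (by omega) (by omega) (by omega)) (by omega) ?_
        omega
    · by_cases hv : coeff σ 5 < 2 * c'
      · obtain ⟨v, hv'⟩ := Nat.exists_eq_add_of_le hv.le
        by_cases hvc : v < c' + 1
        · refine R3 1 0 v (valid3 _ _ _ (by omega) (by omega) (by omega)) (by omega) ?_
          linarith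
        · obtain ⟨u, rfl⟩ := Nat.exists_eq_add_of_le (not_lt.1 hvc)
          refine R3 1 1 u (valid3 _ _ _ (by omega) (by omega) (by omega)) (by omega) ?_
          linarith
      · obtain rfl : c' = 1 := by omega
        by_cases hq' : coeff σ 6 = 2
        · refine R4 1 0 0 1 (valid4 _ _ _ _ ?_ ?_ ?_ ?_) ?_ ?_ <;> omega
        · refine R4 1 0 1 (1 - coeff σ 6) (valid4 _ _ _ _ ?_ ?_ ?_ ?_) ?_ ?_ <;> omega
  · obtain hb : coeff σ 2 = 1 := by omega
    have hy' : coeff σ (j + 3) = c' + 1 := by omega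
    have hd3 : coeff σ 3 ≤ c' := by
      rcases Nat.lt_or_ge 1 j with h | h
      · have := hanti 2 3 (by omega) (by omega) (by omega)
        omega
      · obtain rfl : j = 1 := by omega
        exact hc'.le
    rw [hb] at H2 H3 R2 R3 R4
    rw [hc', hy', hc1] at R2 R3 R4
    rw [hc1] at H2 H3
    -- For m = 3 the target is (c_{j+1}+1)H_2 + u with u = c_1 + c_3 − c_{j+4}.
    by_cases hu : coeff σ (j + 4) < c' + 1 + coeff σ 3
    · obtain ⟨u, hu'⟩ := Nat.exists_eq_add_of_le hu.le
      by_cases huc : u < c' + 1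
      · refine R3 (coeff σ (j + 1) + 1) 0 u
          (valid3 _ _ _ (by omega) (by omega) (by omega)) (by omega) ?_
        rw [H2]
        linarith
      · obtain ⟨v, rfl⟩ := Nat.exists_eq_add_of_le (not_lt.1 huc)
        refine R3 (coeff σ (j + 1) + 1) 1 v
          (valid3 _ _ _ (by omega) (by omega) (by omega)) (by omega) ?_
        rw [H2]
        linarith
    · -- then `j = 2`
      obtain rfl : j = 2 := by
        have h1 : j ≠ 1 := by
          rintro rfl
          norm_num at hc' hu hz
          omega
        by_contra hne
        have := hanti 3 j (by omega) (by omega) (by omega)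
        omega
      norm_num at hc' hy' hu hz hy R4 hlt hup
      have hd3' : coeff σ 3 = 0 := by omega
      have hz' : coeff σ 6 = c' + 1 := by omega
      have hq := hmax 7
      rw [hd3', hc', hz'] at R4
      rw [hd3'] at H3
      -- Only σ = [c_1, 1, 0, c_1−1, c_1, c_1, c_7, …] is left.
      by_cases hq' : coeff σ 7 = c' + 1
      · refine R4 1 0 0 c' (valid4 _ _ _ _ ?_ ?_ ?_ ?_) ?_ ?_ <;> try omega
        rw [H3, H2, hq']
        ring
      · obtain ⟨w, hw⟩ := Nat.exists_eq_add_of_le (show coeff σ 7 ≤ c' by omega)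
        refine R4 1 0 1 w (valid4 _ _ _ _ ?_ ?_ ?_ ?_) ?_ ?_ <;> try omega
        rw [H3, H2]
        linarith

/-! ### The low-order part in general, and the theorem -/

/-- Outside the exceptional case m = s − j + 1 works: on the constant run the two tails differ by δ
= c_{s+2} − c_{j+1}, and R has sum at least c_1 − δ, plus one if m ≥ 2. -/
theorem exists_low_part {σ : List ℕ} {j s : ℕ} (hj : 1 ≤ j) (hjs : j ≤ s) (hc : 2 ≤ coeff σ 1)
    (hmax : ∀ i, coeff σ i ≤ coeff σ 1)
    (hanti : ∀ i k, 1 ≤ i → i ≤ k → k ≤ s + 1 → coeff σ k ≤ coeff σ i)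
    (hlt : coeff σ (j + 1) < coeff σ j) (hconst : coeff σ (j + 1) = coeff σ (s + 1))
    (hup : coeff σ (s + 1) < coeff σ (s + 2)) (hlt1 : coeff σ (s + 2) < coeff σ 1) :
    ∃ m : ℕ, ∃ R : List ℕ, R.length = m ∧ Valid σ 0 R ∧
      value σ R + tail σ (j + 1) m = H σ m + tail σ j m ∧ coeff σ (j + 1) + 2 ≤ R.sum := by
  by_cases hadj : s = j ∧ coeff σ (s + 2) + 1 = coeff σ 1
  · obtain ⟨rfl, hadj⟩ := hadj
    exact exists_low_part_of_adjacent hj hc hmax hanti hlt hup hadj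
  · obtain ⟨a, rfl⟩ := Nat.exists_eq_add_of_le hjs
    have hH := (coeff_one_le_H σ (by omega) a).1
    have hshift := tail_succ_add (σ := σ) (k := j) (m := a) (e := coeff σ (j + 1)) fun i hi => by
      have h1 := hanti (j + 1) (j + i + 1) (by omega) (by omega) (by omega)
      have h2 := hanti (j + i + 1) (j + a + 1) (by omega) (by omega) (by omega)
      omega
    obtain ⟨R, hlen, hv, hval, hs, hs'⟩ := exists_valid_tail_sub (σ := σ) (k := 0) (m := a + 1)
      (δ := coeff σ (j + a + 2) - coeff σ (j + 1)) (by omega) (by omega)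
      (by rw [← H_succ]; omega)
    rw [← H_succ] at hval
    rw [zero_add] at hs hs'
    refine ⟨a + 1, R, hlen, hv, by omega, ?_⟩
    rcases Nat.eq_zero_or_pos a with rfl | ha
    · rw [add_zero] at *
      omega
    · have := hs' (by omega)
      omega

end PLRS

theorem proposition5p3 (σ : List ℕ) (hσ : PLRS.IsSignature σ)
    (hc1 : 2 ≤ PLRS.coeff σ 1)
    (hmax : ∀ i, 1 ≤ i → i ≤ σ.length → PLRS.coeff σ i ≤ PLRS.coeff σ 1)
    (t : ℕ)
    (ht : IsLeast {i | 1 ≤ i ∧ i + 1 ≤ σ.length ∧ PLRS.coeff σ i < PLRS.coeff σ (i + 1)} t)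
    (hlt : PLRS.coeff σ (t + 1) < PLRS.coeff σ 1) :
    ∃ n N : ℕ, PLRS.IsRepresentation σ (PLRS.shifted [PLRS.coeff σ 1 + 1] n) N ∧
      (∃ R, PLRS.IsGZD σ R N) ∧
      ∀ R, PLRS.IsGZD σ R N →
        PLRS.numSummands (PLRS.shifted [PLRS.coeff σ 1 + 1] n) < PLRS.numSummands R := by
  open PLRS in
  have hmax' : ∀ i, coeff σ i ≤ coeff σ 1 := by
    intro i
    rcases i with _ | i
    · simp [coeff]
    by_cases h : 0 < coeff σ (i + 1)
    · exact hmax _ (by omega) (lt_length_of_coeff_pos h)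
    · omega
  obtain ⟨⟨ht1, htL, hup⟩, hleast⟩ := ht
  obtain ⟨s, rfl⟩ := Nat.exists_eq_add_of_le' ht1
  have hanti : ∀ i k, 1 ≤ i → i ≤ k → k ≤ s + 1 → coeff σ k ≤ coeff σ i := by
    intro i k hi hik
    induction k, hik using Nat.le_induction with
    | base => intro _; exact le_rfl
    | succ k hik ih =>
      intro hk
      refine le_trans ?_ (ih (by omega))
      by_contra hcon
      have := hleast (show k ∈ _ from ⟨by omega, by omega, not_le.1 hcon⟩)
      omega
  have hex : ∃ j, coeff σ (j + 1) ≤ coeff σ (s + 1) := ⟨s, le_rfl⟩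
  classical
  -- Minimality puts a strict descent just before the constant run; j = 0 is excluded by c_{s+1} <
  -- c_{s+2} < c_1.
  obtain ⟨j, hj, hmin⟩ : ∃ j, coeff σ (j + 1) ≤ coeff σ (s + 1) ∧
      ∀ i < j, coeff σ (s + 1) < coeff σ (i + 1) :=
    ⟨Nat.find hex, Nat.find_spec hex, fun i hi => not_le.1 (Nat.find_min hex hi)⟩
  have hjs : j ≤ s := by
    by_contra h
    exact lt_irrefl _ (hmin s (by omega))
  have hj1 : 1 ≤ j := by
    rcases Nat.eq_zero_or_pos j with rfl | h
    · simp only [zero_add] at hj; omega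
    · exact h
  have hdesc : coeff σ (j + 1) < coeff σ j := by
    have := hmin (j - 1) (by omega)
    rw [Nat.sub_add_cancel hj1] at this
    omega
  have hconst := le_antisymm hj (hanti (j + 1) (s + 1) (by omega) (by omega) le_rfl)
  obtain ⟨m, R, hlen, hv, hval, hsum⟩ :=
    exists_low_part hj1 hjs hc1 hmax' hanti hdesc hconst hup hlt
  obtain ⟨R', hv', hval', hsum'⟩ := exists_valid_of_low_part hj1 hc1 hmax'
    (fun i h1 h2 => hanti i (i + 1) h1 (by omega) (by omega)) hdesc hlen hv hval
  refine ⟨j + m, (coeff σ 1 + 1) * H σ (j + m), ?_, ⟨R', (isGZD_iff hσ.1).2 ⟨hval', hv'⟩⟩, ?_⟩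
  · simp [IsRepresentation, shifted, value, value_replicate_zero]
  · intro S hS
    obtain ⟨hSval, hSv⟩ := (isGZD_iff hσ.1).1 hS
    have := hSv.sum_eq (by omega) hv' (by rw [hSval, hval'])
    simp only [numSummands, shifted, List.sum_append, List.sum_cons, List.sum_nil,
      List.sum_replicate, smul_zero]
    omega
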